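/- Let $G$ be a finite simple undirected graph. A coloring of $G$ is a partition of $V(G)$ into (nonempty) sets of pairwise nonadjacent vertices; its size is the number of its classes, and $\chi(G)$ is the smallest size of a coloring of $G$. A clique minor of $G$ is a set of pairwise disjoint nonempty subsets of $V(G)$, each inducing a connected subgraph of $G$, such that between any two distinct members there is an edge of $G$; let $h(G)$ be the largest $k$ such that $G$ has a clique minor of size $k$. If $\chi(G) \leq 6$ and $G$ has exactly one coloring of size $\chi(G)$, then $h(G) \geq \chi(G)$. -/

import Mathlib

namespace SimpleGraph

/-- A clique minor of `G`: a set of pairwise disjoint, pairwise adjacent, connected, nonempty sets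
of vertices. Two sets of vertices are adjacent if some edge has an end in each of them, and a set
of vertices is connected if it induces a connected subgraph. -/
structure IsCliqueMinor {V : Type*} (G : SimpleGraph V) (K : Set (Set V)) : Prop where
  nonempty : ∀ A ∈ K, A.Nonempty
  connected : ∀ A ∈ K, (G.induce A).Connected
  disjoint : ∀ A ∈ K, ∀ B ∈ K, A ≠ B → Disjoint A B
  adjacent : ∀ A ∈ K, ∀ B ∈ K, A ≠ B → ∃ a ∈ A, ∃ b ∈ B, G.Adj a b

/-- The Hadwiger number `h(G)`: the supremum of the sizes of the clique minors of `G`; on a finite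
graph this is the largest size of a clique minor. -/
noncomputable def hadwigerNumber {V : Type*} (G : SimpleGraph V) : ℕ∞ :=
  ⨆ (K : Set (Set V)) (_ : G.IsCliqueMinor K), K.encard

end SimpleGraph

/-! In the unique coloring with k = χ(G) classes, any two classes together induce a connected graph:
otherwise swapping the two colors on one component would give a different partition. Each pair of
classes of sizes a, b thus spans at least a + b - 1 edges, and summing over pairs gives at least (k
- 1)n - C(k, 2) edges (`mul_card_le_of_connected`). For k ≤ 6 this many edges force a clique minor
of size k, by Mader's induction (`hasCliqueMinor_of_mul_card_le`): contract edges with few common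
neighbors until some vertex has a small, dense neighborhood, find a minor of size k - 1 there, and
add the vertex. -/

namespace SimpleGraph

universe u v

variable {V : Type u} {W : Type v}

/-! ### Clique minors and the operations that transport them -/

/-- `G` has a clique minor of size `k`, given by an indexed family of branch sets. -/
def HasCliqueMinor (G : SimpleGraph V) (k : ℕ) : Prop :=
  ∃ B : Fin k → Set V, (∀ i, (G.induce (B i)).Connected) ∧
    ∀ i j, i ≠ j → Disjoint (B i) (B j) ∧ ∃ a ∈ B i, ∃ b ∈ B j, G.Adj a b

theorem HasCliqueMinor.le_hadwigerNumber {G : SimpleGraph V} {k : ℕ} (h : G.HasCliqueMinor k) :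
    (k : ℕ∞) ≤ G.hadwigerNumber := by
  obtain ⟨B, hc, hB⟩ := h
  have hne : ∀ i, (B i).Nonempty := fun i => Set.nonempty_coe_sort.1 (hc i).nonempty
  have hinj : Function.Injective B := by
    intro i j hij
    by_contra hne'
    have := (hB i j hne').1
    rw [hij, disjoint_self] at this
    exact (hne j).ne_empty this
  have hK : G.IsCliqueMinor (Set.range B) := by
    refine ⟨?_, ?_, ?_, ?_⟩
    · rintro _ ⟨i, rfl⟩
      exact hne i
    · rintro _ ⟨i, rfl⟩
      exact hc i
    · rintro _ ⟨i, rfl⟩ _ ⟨j, rfl⟩ hij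
      exact (hB i j fun h => hij (h ▸ rfl)).1
    · rintro _ ⟨i, rfl⟩ _ ⟨j, rfl⟩ hij
      exact (hB i j fun h => hij (h ▸ rfl)).2
  have hcard : (Set.range B).encard = k := by
    rw [← Set.image_univ, hinj.encard_image, Set.encard_univ]
    simp
  rw [← hcard]
  exact le_iSup₂ (f := fun (K : Set (Set V)) (_ : G.IsCliqueMinor K) => K.encard) _ hK

theorem connected_induce_image {G : SimpleGraph V} {H : SimpleGraph W} (f : H →g G) {s : Set W}
    (hs : (H.induce s).Connected) : (G.induce (f '' s)).Connected := by
  let g : H.induce s →g G.induce (f '' s) :=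
    ⟨fun x => ⟨f x, x, x.2, rfl⟩, fun {a b} h => f.map_adj h⟩
  refine hs.map g ?_
  rintro ⟨_, x, hx, rfl⟩
  exact ⟨⟨x, hx⟩, rfl⟩

theorem HasCliqueMinor.map {G : SimpleGraph V} {H : SimpleGraph W} {k : ℕ} (f : H →g G)
    (hf : Function.Injective f) (h : H.HasCliqueMinor k) : G.HasCliqueMinor k := by
  obtain ⟨B, hc, hB⟩ := h
  refine ⟨fun i => f '' B i, fun i => connected_induce_image f (hc i), fun i j hij => ?_⟩
  obtain ⟨hd, a, ha, b, hb, hab⟩ := hB i j hij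
  exact ⟨(Set.disjoint_image_iff hf).2 hd, f a, ⟨a, ha, rfl⟩, f b, ⟨b, hb, rfl⟩, f.map_adj hab⟩

theorem HasCliqueMinor.mono {G H : SimpleGraph V} {k : ℕ} (hle : H ≤ G)
    (h : H.HasCliqueMinor k) : G.HasCliqueMinor k :=
  h.map (Hom.ofLE hle) fun _ _ => id

/-- Each edge of a walk in `H` lifts to an edge of `G`; consecutive lifts are joined inside the
connected fibres. -/
theorem connected_induce_preimage {G : SimpleGraph V} {H : SimpleGraph W} (f : V → W)
    (hfib : ∀ w, (G.induce (f ⁻¹' {w})).Connected)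
    (hadj : ∀ x y, H.Adj x y → ∃ a b, f a = x ∧ f b = y ∧ G.Adj a b) {s : Set W}
    (hs : (H.induce s).Connected) : (G.induce (f ⁻¹' s)).Connected := by
  have hfibre : ∀ a b : f ⁻¹' s, f a = f b → (G.induce (f ⁻¹' s)).Reachable a b := by
    intro a b hab
    have hsub : f ⁻¹' {f b} ⊆ f ⁻¹' s := by
      intro x hx
      have hx' : f x = f b := hx
      rw [Set.mem_preimage, hx']
      exact b.2
    exact ((hfib (f b)).preconnected ⟨a, hab⟩ ⟨b, rfl⟩).map (G.induceHomOfLE hsub).toHom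
  have key : ∀ p q : s, (H.induce s).Walk p q → ∀ a b : f ⁻¹' s, f a = p → f b = q →
      (G.induce (f ⁻¹' s)).Reachable a b := by
    intro p q w
    induction w with
    | nil => exact fun a b ha hb => hfibre a b (ha.trans hb.symm)
    | @cons p r q h w ih =>
      intro a b ha hb
      obtain ⟨x, y, hx, hy, hxy⟩ := hadj p r h
      have hxs : x ∈ f ⁻¹' s := by rw [Set.mem_preimage, hx]; exact p.2
      have hys : y ∈ f ⁻¹' s := by rw [Set.mem_preimage, hy]; exact r.2
      have h1 := hfibre a ⟨x, hxs⟩ (ha.trans hx.symm)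
      have h2 : (G.induce (f ⁻¹' s)).Adj ⟨x, hxs⟩ ⟨y, hys⟩ := hxy
      exact (h1.trans h2.reachable).trans (ih ⟨y, hys⟩ b hy hb)
  have : Nonempty (f ⁻¹' s) := by
    obtain ⟨w⟩ := hs.nonempty
    obtain ⟨x, hx⟩ := (hfib w).nonempty
    have hx' : f x = w := hx
    exact ⟨⟨x, by rw [Set.mem_preimage, hx']; exact w.2⟩⟩
  refine ⟨fun a b => ?_⟩
  obtain ⟨w⟩ := hs.preconnected ⟨f a, a.2⟩ ⟨f b, b.2⟩
  exact key _ _ w a b rfl rfl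

theorem HasCliqueMinor.of_contraction {G : SimpleGraph V} {H : SimpleGraph W} {k : ℕ} (f : V → W)
    (hfib : ∀ w, (G.induce (f ⁻¹' {w})).Connected)
    (hadj : ∀ x y, H.Adj x y → ∃ a b, f a = x ∧ f b = y ∧ G.Adj a b)
    (h : H.HasCliqueMinor k) : G.HasCliqueMinor k := by
  obtain ⟨B, hc, hB⟩ := h
  refine ⟨fun i => f ⁻¹' B i, fun i => connected_induce_preimage f hfib hadj (hc i),
    fun i j hij => ?_⟩
  obtain ⟨hd, x, hx, y, hy, hxy⟩ := hB i j hij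
  obtain ⟨a, b, rfl, rfl, hab⟩ := hadj x y hxy
  exact ⟨hd.preimage f, a, hx, b, hy, hab⟩

theorem connected_induce_singleton (G : SimpleGraph V) (v : V) :
    (G.induce {v}).Connected := by
  exact Connected.of_subsingleton

theorem HasCliqueMinor.of_neighborSet {G : SimpleGraph V} {k : ℕ} {v : V}
    (h : (G.induce (G.neighborSet v)).HasCliqueMinor k) : G.HasCliqueMinor (k + 1) := by
  obtain ⟨B, hc, hB⟩ := h
  let f : G.induce (G.neighborSet v) →g G := (Embedding.induce _).toHom
  have hf : ∀ x, f x = x.1 := fun _ => rfl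
  have hv : ∀ i, Disjoint {v} (f '' B i) ∧ ∃ a ∈ ({v} : Set V), ∃ b ∈ f '' B i, G.Adj a b := by
    intro i
    constructor
    · rw [Set.disjoint_singleton_left]
      rintro ⟨x, -, hx⟩
      exact G.ne_of_adj x.2 hx.symm
    · obtain ⟨x, hx⟩ := (hc i).nonempty
      exact ⟨v, rfl, f x, ⟨x, hx, rfl⟩, x.2⟩
  refine ⟨Fin.cons {v} fun i => f '' B i, fun i => ?_, ?_⟩
  · cases i using Fin.cases with
    | zero => exact connected_induce_singleton G v
    | succ i => exact connected_induce_image f (hc i)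
  · intro i j hij
    cases i using Fin.cases with
    | zero =>
      cases j using Fin.cases with
      | zero => exact absurd rfl hij
      | succ j => exact hv j
    | succ i =>
      cases j using Fin.cases with
      | zero =>
        obtain ⟨hd, a, ha, b, hb, hab⟩ := hv i
        exact ⟨hd.symm, b, hb, a, ha, hab.symm⟩
      | succ j =>
        obtain ⟨hd, a, ha, b, hb, hab⟩ := hB i j fun h => hij (h ▸ rfl)
        exact ⟨(Set.disjoint_image_iff Subtype.val_injective).2 hd, f a, ⟨a, ha, rfl⟩, f b,
          ⟨b, hb, rfl⟩, hab⟩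

theorem hasCliqueMinor_of_pairwise_adj {G : SimpleGraph V} {k : ℕ} (f : Fin k → V)
    (hf : ∀ i j, i ≠ j → G.Adj (f i) (f j)) : G.HasCliqueMinor k :=
  ⟨fun i => {f i}, fun _ => connected_induce_singleton G _, fun i j hij =>
    ⟨Set.disjoint_singleton.2 (hf i j hij).ne, _, rfl, _, rfl, hf i j hij⟩⟩

theorem hasCliqueMinor_top [Finite V] {k : ℕ} (hk : k ≤ Nat.card V) :
    (⊤ : SimpleGraph V).HasCliqueMinor k := by
  refine hasCliqueMinor_of_pairwise_adj (fun i => (Finite.equivFin V).symm (Fin.castLE hk i)) ?_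
  intro i j hij h
  exact hij (Fin.castLE_injective hk ((Finite.equivFin V).symm.injective h))

/-! ### Edge contraction and edge counts -/

/-- The graph obtained from `G` by deleting `v` and joining `u` to the neighbors of `v`. -/
def contract (G : SimpleGraph V) (u v : V) : SimpleGraph {x // x ≠ v} where
  Adj x y := x ≠ y ∧ (G.Adj x y ∨ x.1 = u ∧ G.Adj v y ∨ y.1 = u ∧ G.Adj v x)
  symm := ⟨fun x y ⟨h, h'⟩ => ⟨h.symm, by
    rcases h' with h' | h' | h'
    · exact Or.inl h'.symm
    · exact Or.inr (Or.inr h')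
    · exact Or.inr (Or.inl h')⟩⟩
  loopless := ⟨fun x h => h.1 rfl⟩

theorem HasCliqueMinor.of_contract {G : SimpleGraph V} {k : ℕ} {u v : V} (huv : G.Adj u v)
    (h : (G.contract u v).HasCliqueMinor k) : G.HasCliqueMinor k := by
  classical
  let f : V → {x // x ≠ v} := fun x => if hx : x = v then ⟨u, huv.ne⟩ else ⟨x, hx⟩
  have hfv : f v = ⟨u, huv.ne⟩ := dif_pos rfl
  have hf : ∀ x : {x // x ≠ v}, f x = x := fun x => dif_neg x.2
  refine h.of_contraction f ?_ ?_
  · rintro ⟨w, hw⟩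
    by_cases hwu : w = u
    · subst hwu
      have : f ⁻¹' {⟨w, hw⟩} = {w, v} := by
        ext x
        by_cases hx : x = v
        · simp [hx, hfv]
        · simp [hf ⟨x, hx⟩, hx]
      rw [this]
      exact induce_pair_connected_of_adj huv
    · have : f ⁻¹' {⟨w, hw⟩} = {w} := by
        ext x
        by_cases hx : x = v
        · simp [hx, hfv, Ne.symm hwu, Ne.symm hw]
        · simp [hf ⟨x, hx⟩]
      rw [this]
      exact connected_induce_singleton G w
  · rintro x y ⟨-, h | ⟨hx, h⟩ | ⟨hy, h⟩⟩
    · exact ⟨x, y, hf x, hf y, h⟩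
    · exact ⟨v, y, hfv.trans (Subtype.ext hx.symm), hf y, h⟩
    · exact ⟨x, v, hf x, hfv.trans (Subtype.ext hy.symm), h.symm⟩

/-- Contracting `uv` loses that edge and, for each common neighbor, one of two edges that become
parallel. -/
theorem ncard_edgeSet_le_contract [Finite V] {G : SimpleGraph V} {u v : V} (huv : G.Adj u v) :
    G.edgeSet.ncard ≤ (G.contract u v).edgeSet.ncard + ((G.commonNeighbors u v).ncard + 1) := by
  classical
  -- An edge of the contraction absent from `G` comes from an edge at `v`; the swap moves its end
  -- `u` back to `v`.
  let g : Sym2 {x // x ≠ v} → Sym2 V := fun e =>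
    if e.map (↑) ∈ G.edgeSet then e.map (↑) else e.map fun x : {x // x ≠ v} => Equiv.swap u v x
  have hsub : G.edgeSet ⊆ g '' (G.contract u v).edgeSet ∪
      (fun w => s(v, w)) '' insert u (G.commonNeighbors u v) := by
    have hv : ∀ y, G.Adj v y → s(v, y) ∈ g '' (G.contract u v).edgeSet ∪
        (fun w => s(v, w)) '' insert u (G.commonNeighbors u v) := by
      intro y hy
      by_cases hyu : y = u
      · exact Or.inr ⟨y, Or.inl hyu, rfl⟩
      by_cases hc : G.Adj u y
      · exact Or.inr ⟨y, Or.inr ⟨hc, hy⟩, rfl⟩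
      refine Or.inl ⟨s(⟨u, huv.ne⟩, ⟨y, hy.ne'⟩), ?_, ?_⟩
      · exact ⟨fun h => hyu (congrArg Subtype.val h).symm, Or.inr (Or.inl ⟨rfl, hy⟩)⟩
      · have : ¬ s(u, y) ∈ G.edgeSet := hc
        simp only [g, Sym2.map_mk, this, if_false, Equiv.swap_apply_left,
          Equiv.swap_apply_of_ne_of_ne hyu hy.ne']
    intro e
    induction e using Sym2.ind with
    | _ x y =>
      intro hxy
      have hxy' : G.Adj x y := hxy
      by_cases hx : x = v
      · subst hx
        exact hv y hxy'
      by_cases hy : y = v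
      · subst hy
        rw [Sym2.eq_swap]
        exact hv x hxy'.symm
      refine Or.inl ⟨s(⟨x, hx⟩, ⟨y, hy⟩), ?_, ?_⟩
      · exact ⟨fun h => hxy'.ne (congrArg Subtype.val h), Or.inl hxy'⟩
      · exact if_pos hxy
  calc G.edgeSet.ncard ≤ _ := Set.ncard_le_ncard hsub (Set.toFinite _)
    _ ≤ _ := Set.ncard_union_le _ _
    _ ≤ _ := add_le_add (Set.ncard_image_le (Set.toFinite _))
      ((Set.ncard_image_le (Set.toFinite _)).trans (Set.ncard_insert_le _ _))

theorem ncard_edgeSet_le_induce_of_isolated [Finite V] {G : SimpleGraph V} {v : V}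
    (hv : ∀ u, ¬ G.Adj v u) : G.edgeSet.ncard ≤ (G.induce {x | x ≠ v}).edgeSet.ncard := by
  have hsub : G.edgeSet ⊆ Sym2.map (↑) '' (G.induce {x | x ≠ v}).edgeSet := by
    intro e
    induction e using Sym2.ind with
    | _ x y =>
      intro hxy
      have hxy' : G.Adj x y := hxy
      exact ⟨s(⟨x, fun h => hv y (h ▸ hxy')⟩, ⟨y, fun h => hv x (h ▸ hxy'.symm)⟩), hxy, rfl⟩
  exact (Set.ncard_le_ncard hsub (Set.toFinite _)).trans (Set.ncard_image_le (Set.toFinite _))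

theorem sum_ncard_neighborSet [Fintype V] (G : SimpleGraph V) :
    ∑ v, (G.neighborSet v).ncard = 2 * G.edgeSet.ncard := by
  classical
  rw [Set.ncard_eq_toFinset_card', ← edgeFinset, ← sum_degrees_eq_twice_card_edges]
  refine Finset.sum_congr rfl fun v _ => ?_
  rw [Set.ncard_eq_toFinset_card', ← card_neighborSet_eq_degree, Set.toFinset_card]

theorem exists_le_ncard_edgeSet_eq [Finite V] (G : SimpleGraph V) {m : ℕ}
    (hm : m ≤ G.edgeSet.ncard) : ∃ H ≤ G, H.edgeSet.ncard = m := by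
  obtain ⟨s, hs, hcard⟩ := Set.exists_subset_card_eq hm
  refine ⟨fromEdgeSet s, ?_, ?_⟩
  · exact (fromEdgeSet_mono hs).trans_eq (fromEdgeSet_edgeSet G)
  · rw [edgeSet_fromEdgeSet, sdiff_eq_left.2, hcard]
    exact Set.disjoint_left.2 fun e he hd => G.not_isDiag_of_mem_edgeSet (hs he) hd

theorem eq_top_of_choose_two_le [Finite V] {G : SimpleGraph V}
    (h : (Nat.card V).choose 2 ≤ G.edgeSet.ncard) : G = ⊤ := by
  classical
  have := Fintype.ofFinite V
  rw [Set.ncard_eq_toFinset_card', ← edgeFinset, Nat.card_eq_fintype_card,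
    ← card_edgeFinset_top_eq_card_choose_two] at h
  rw [← edgeFinset_inj]
  exact Finset.eq_of_subset_of_card_le (edgeFinset_mono le_top) h

/-! ### Edge bounds that force clique minors -/

theorem hasCliqueMinor_of_mul_card_le {k α β : ℕ} (hβ : 0 < β)
    (hk : α * (k + 1) = (k + 1).choose 2 + β)
    (hlocal : ∀ (U : Type u) [Finite U] [Nonempty U] (H : SimpleGraph U),
      (∀ v, α ≤ (H.neighborSet v).ncard) → Nat.card U < 2 * α → H.HasCliqueMinor k)
    (n : ℕ) : ∀ (V : Type u) [Finite V] (G : SimpleGraph V), Nat.card V = n → k + 1 ≤ n →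
      α * n ≤ G.edgeSet.ncard + β → G.HasCliqueMinor (k + 1) := by
  induction n with
  | zero => intro V _ G _ h; omega
  | succ n ih =>
    intro V _ G hn hkn he
    -- By `hk`, on `k + 1` vertices the edge bound already forces a complete graph.
    rcases hkn.eq_or_lt with hkn | hkn
    · rw [← hkn, hk] at he
      rw [eq_top_of_choose_two_le (G := G) (by rw [hn, ← hkn]; omega)]
      exact hasCliqueMinor_top (by omega)
    have hβle : β ≤ α * (n + 1) := by
      have := Nat.mul_le_mul_left α hkn.le
      omega
    -- Trimming to exactly this many edges keeps the average degree below `2 * α`, as `β > 0`.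
    obtain ⟨H, hle, hH⟩ := exists_le_ncard_edgeSet_eq G (m := α * (n + 1) - β) (by omega)
    refine HasCliqueMinor.mono hle ?_
    clear he hle G
    have hcard : ∀ v : V, Nat.card {x // x ≠ v} = n := by
      intro v
      classical
      have := Fintype.ofFinite V
      rw [Nat.card_eq_fintype_card] at hn ⊢
      rw [Fintype.card_subtype_compl, hn]
      simp
    have hmul : α * (n + 1) = α * n + α := by ring
    by_cases hiso : ∃ v, ∀ u, ¬ H.Adj v u
    · obtain ⟨v, hv⟩ := hiso
      have h1 := ncard_edgeSet_le_induce_of_isolated hv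
      exact (ih ({x | x ≠ v} : Set V) (H.induce {x | x ≠ v}) (hcard v) (by omega) (by omega)).map
        (Embedding.induce _).toHom Subtype.val_injective
    -- Contracting such an edge costs at most `α` edges, which the induction affords.
    by_cases hcon : ∃ u v, H.Adj u v ∧ (H.commonNeighbors u v).ncard < α
    · obtain ⟨u, v, huv, hc⟩ := hcon
      have h1 := ncard_edgeSet_le_contract huv
      exact (ih {x // x ≠ v} (H.contract u v) (hcard v) (by omega) (by omega)).of_contract huv
    push Not at hiso hcon
    have hdeg : ∃ v, (H.neighborSet v).ncard < 2 * α := by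
      by_contra! hall
      have := Fintype.ofFinite V
      have h1 := sum_ncard_neighborSet H
      have h2 : ∑ _v : V, 2 * α ≤ ∑ v, (H.neighborSet v).ncard :=
        Finset.sum_le_sum fun v _ => hall v
      rw [Nat.card_eq_fintype_card] at hn
      rw [Finset.sum_const, Finset.card_univ, hn, h1, hH, smul_eq_mul] at h2
      have h3 : (n + 1) * (2 * α) = 2 * (α * (n + 1)) := by ring
      omega
    obtain ⟨v, hv⟩ := hdeg
    obtain ⟨u, hu⟩ := hiso v
    have : Nonempty (H.neighborSet v) := ⟨⟨u, hu⟩⟩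
    refine HasCliqueMinor.of_neighborSet (v := v) (hlocal _ _ ?_ hv)
    rintro ⟨w, hw⟩
    refine (hcon v w hw).trans ?_
    rw [← Set.ncard_image_of_injective _ Subtype.val_injective]
    refine Set.ncard_le_ncard ?_ (Set.toFinite _)
    rintro x ⟨hx, hx'⟩
    exact ⟨⟨x, hx⟩, hx', rfl⟩

theorem mul_card_le_two_mul_ncard_edgeSet [Finite V] {G : SimpleGraph V} {d : ℕ}
    (h : ∀ v, d ≤ (G.neighborSet v).ncard) : d * Nat.card V ≤ 2 * G.edgeSet.ncard := by
  have := Fintype.ofFinite V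
  rw [← sum_ncard_neighborSet, Nat.card_eq_fintype_card, mul_comm, ← smul_eq_mul,
    ← Finset.card_univ, ← Finset.sum_const]
  exact Finset.sum_le_sum fun v _ => h v

theorem lt_card_of_le_ncard_neighborSet [Finite V] {G : SimpleGraph V} {d : ℕ} {v : V}
    (h : d ≤ (G.neighborSet v).ncard) : d < Nat.card V := by
  refine h.trans_lt ?_
  rw [← Set.ncard_univ]
  refine Set.ncard_lt_ncard ⟨Set.subset_univ _, fun h' => ?_⟩ (Set.toFinite _)
  exact G.irrefl (h' (Set.mem_univ v))

theorem hasCliqueMinor_one [Nonempty V] (G : SimpleGraph V) : G.HasCliqueMinor 1 :=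
  hasCliqueMinor_of_pairwise_adj (fun _ => Classical.arbitrary V)
    fun i j hij => absurd (Subsingleton.elim i j) hij

theorem hasCliqueMinor_two [Finite V] {G : SimpleGraph V} (hn : 2 ≤ Nat.card V)
    (he : Nat.card V ≤ G.edgeSet.ncard + 1) : G.HasCliqueMinor 2 :=
  hasCliqueMinor_of_mul_card_le (k := 1) (α := 1) (β := 1) (by norm_num) (by decide)
    (fun _ _ _ H _ _ => hasCliqueMinor_one H) _ V G rfl hn (by omega)

theorem hasCliqueMinor_three [Finite V] {G : SimpleGraph V} (hn : 3 ≤ Nat.card V)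
    (he : 2 * Nat.card V ≤ G.edgeSet.ncard + 3) : G.HasCliqueMinor 3 := by
  refine hasCliqueMinor_of_mul_card_le (k := 2) (α := 2) (β := 3) (by norm_num) (by decide)
    ?_ _ V G rfl hn he
  intro U _ _ H hdeg hU
  have h1 := mul_card_le_two_mul_ncard_edgeSet hdeg
  have h2 := lt_card_of_le_ncard_neighborSet (hdeg (Classical.arbitrary U))
  exact hasCliqueMinor_two h2.le (by omega)

theorem hasCliqueMinor_four [Finite V] {G : SimpleGraph V} (hn : 4 ≤ Nat.card V)
    (he : 2 * Nat.card V ≤ G.edgeSet.ncard + 2) : G.HasCliqueMinor 4 := by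
  refine hasCliqueMinor_of_mul_card_le (k := 3) (α := 2) (β := 2) (by norm_num) (by decide)
    ?_ _ V G rfl hn he
  intro U _ _ H hdeg hU
  have h1 := mul_card_le_two_mul_ncard_edgeSet hdeg
  have h2 := lt_card_of_le_ncard_neighborSet (hdeg (Classical.arbitrary U))
  have h3 : Nat.card U = 3 := by omega
  rw [eq_top_of_choose_two_le (G := H) (by rw [h3, show Nat.choose 3 2 = 3 by decide]; omega)]
  exact hasCliqueMinor_top h2

theorem hasCliqueMinor_five [Finite V] {G : SimpleGraph V} (hn : 5 ≤ Nat.card V)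
    (he : 3 * Nat.card V ≤ G.edgeSet.ncard + 5) : G.HasCliqueMinor 5 := by
  refine hasCliqueMinor_of_mul_card_le (k := 4) (α := 3) (β := 5) (by norm_num) (by decide)
    ?_ _ V G rfl hn he
  intro U _ _ H hdeg hU
  have h1 := mul_card_le_two_mul_ncard_edgeSet hdeg
  have h2 := lt_card_of_le_ncard_neighborSet (hdeg (Classical.arbitrary U))
  exact hasCliqueMinor_four h2 (by omega)

theorem hasCliqueMinor_six [Finite V] {G : SimpleGraph V} (hn : 6 ≤ Nat.card V)
    (he : 5 * Nat.card V ≤ G.edgeSet.ncard + 15) : G.HasCliqueMinor 6 := by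
  refine hasCliqueMinor_of_mul_card_le (k := 5) (α := 5) (β := 15) (by norm_num) (by decide)
    ?_ _ V G rfl hn he
  intro U _ _ H hdeg hU
  have h1 := mul_card_le_two_mul_ncard_edgeSet hdeg
  have h2 := lt_card_of_le_ncard_neighborSet (hdeg (Classical.arbitrary U))
  -- Here 6 ≤ |U| ≤ 9, and 5|U|/2 ≥ 3|U| - 5 holds up to |U| = 10.
  exact hasCliqueMinor_five (by omega) (by omega)

/-! ### Unique colorings: Kempe chains and the edge count -/

theorem connected_induce_of_unique_coloring {G : SimpleGraph V} {α : Type v} (c : G.Coloring α)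
    (hc : Function.Surjective c)
    (huniq : ∀ c' : G.Coloring α, ∀ x y, c x = c y ↔ c' x = c' y) {i j : α} (hij : i ≠ j) :
    (G.induce {x | c x = i ∨ c x = j}).Connected := by
  classical
  have hne : Nonempty {x | c x = i ∨ c x = j} := by
    obtain ⟨x, hx⟩ := hc i
    exact ⟨⟨x, Or.inl hx⟩⟩
  refine ⟨fun x y => ?_⟩
  by_contra hxy
  let X : Set V := {z | ∃ hz, (G.induce {x | c x = i ∨ c x = j}).Reachable x ⟨z, hz⟩}
  have hX : ∀ z w, G.Adj z w → z ∈ X → w ∉ X → Equiv.swap i j (c z) ≠ c w := by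
    rintro z w hzw ⟨hz, hxz⟩ hw heq
    refine hw ⟨?_, hxz.trans (Adj.reachable ?_)⟩
    · rcases hz with hz | hz
      · exact Or.inr (by rw [← heq, hz, Equiv.swap_apply_left])
      · exact Or.inl (by rw [← heq, hz, Equiv.swap_apply_right])
    · exact hzw
  let c' : G.Coloring α := Coloring.mk (fun z => if z ∈ X then Equiv.swap i j (c z) else c z) <| by
    intro z w hzw
    by_cases hz : z ∈ X <;> by_cases hw : w ∈ X
    · simpa only [hz, hw, if_true] using fun h => c.valid hzw ((Equiv.swap i j).injective h)
    · simpa only [hz, hw, if_true, if_false] using hX z w hzw hz hw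
    · simpa only [hz, hw, if_true, if_false] using (hX w z hzw.symm hw hz).symm
    · simpa only [hz, hw, if_false] using c.valid hzw
  have hx : c' x = Equiv.swap i j (c x) := if_pos ⟨x.2, Reachable.refl _⟩
  have hy : c' y = c y := if_neg fun ⟨_, h⟩ => hxy h
  have hiff := huniq c' x y
  rw [hx, hy] at hiff
  -- Only `x` is recolored, so `c'` reverses whether `x` and `y` share a color.
  rcases x.2 with h | h <;> rcases y.2 with h' | h' <;>
    simp [h, h', hij, hij.symm] at hiff

/-- A connected graph has at least one edge fewer than vertices. Darts from color `i` to color `j`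
count each edge between the classes once, which suits a sum over ordered pairs. -/
theorem card_add_card_le_of_connected [Fintype V] [DecidableEq V] {G : SimpleGraph V}
    [DecidableRel G.Adj] {α : Type v} [DecidableEq α] (c : G.Coloring α) {i j : α} (hij : i ≠ j)
    (h : (G.induce {x | c x = i ∨ c x = j}).Connected) :
    (Finset.univ.filter fun x => c x = i).card + (Finset.univ.filter fun x => c x = j).card ≤
      (Finset.univ.filter fun d : G.Dart => (c d.fst, c d.snd) = (i, j)).card + 1 := by
  have h1 := h.card_vert_le_card_edgeSet_add_one
  have h2 : Nat.card {x | c x = i ∨ c x = j} = (Finset.univ.filter fun x => c x = i).card +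
      (Finset.univ.filter fun x => c x = j).card := by
    rw [← Finset.card_union_of_disjoint, ← Finset.filter_or, Nat.card_eq_fintype_card]
    · exact Fintype.card_subtype _
    · exact Finset.disjoint_filter.2 fun x _ hx hx' => hij (hx.symm.trans hx')
  have hsub : (Sym2.map (↑) '' (G.induce {x | c x = i ∨ c x = j}).edgeSet) ⊆
      Dart.edge '' (Finset.univ.filter fun d : G.Dart =>
        (c d.fst, c d.snd) = (i, j) : Set G.Dart) := by
    rintro _ ⟨e, he, rfl⟩
    induction e using Sym2.ind with
    | _ x y =>
      have hxy : G.Adj x y := he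
      have hne := c.valid hxy
      rcases x.2 with hx | hx <;> rcases y.2 with hy | hy
      · exact absurd (hx.trans hy.symm) hne
      · exact ⟨⟨(x, y), hxy⟩, by simp [hx, hy], rfl⟩
      · exact ⟨⟨(y, x), hxy.symm⟩, by simp [hx, hy], Sym2.eq_swap⟩
      · exact absurd (hx.trans hy.symm) hne
  have h3 := (Set.ncard_le_ncard hsub (Set.toFinite _)).trans (Set.ncard_image_le (Set.toFinite _))
  rw [Set.ncard_image_of_injective _ (Sym2.map.injective Subtype.val_injective),
    Set.ncard_coe_finset] at h3
  rw [Nat.card_coe_set_eq (SimpleGraph.edgeSet _)] at h1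
  omega

theorem mul_card_le_of_connected [Finite V] {G : SimpleGraph V} {k : ℕ} (c : G.Coloring (Fin k))
    (h : ∀ i j, i ≠ j → (G.induce {x | c x = i ∨ c x = j}).Connected) :
    (k - 1) * Nat.card V ≤ G.edgeSet.ncard + k.choose 2 := by
  classical
  have := Fintype.ofFinite V
  let a : Fin k → ℕ := fun i => (Finset.univ.filter fun x => c x = i).card
  have ha : ∑ i, a i = Nat.card V := by
    rw [Nat.card_eq_fintype_card, ← Finset.card_univ]
    exact (Finset.card_eq_sum_card_fiberwise fun _ _ => Finset.mem_univ _).symm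
  have hd : ∑ p ∈ (Finset.univ : Finset (Fin k)).offDiag,
      (Finset.univ.filter fun d : G.Dart => (c d.fst, c d.snd) = p).card = 2 * G.edgeSet.ncard := by
    rw [Set.ncard_eq_toFinset_card', ← edgeFinset, ← dart_card_eq_twice_card_edges,
      ← Finset.card_univ]
    refine (Finset.card_eq_sum_card_fiberwise fun d _ => ?_).symm
    simpa using c.valid d.adj
  have hle := Finset.sum_le_sum fun (p : Fin k × Fin k)
    (hp : p ∈ (Finset.univ : Finset (Fin k)).offDiag) =>
      card_add_card_le_of_connected c (Finset.mem_offDiag.1 hp).2.2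
        (h _ _ (Finset.mem_offDiag.1 hp).2.2)
  rw [Finset.sum_add_distrib, Finset.sum_add_distrib, hd, Finset.sum_const,
    Finset.offDiag_card, Finset.card_univ, Fintype.card_fin, smul_eq_mul, mul_one] at hle
  have hoff : (Finset.univ : Finset (Fin k)).offDiag = Finset.univ.filter fun p => p.1 ≠ p.2 := by
    ext p
    simp
  have hfst : ∑ p ∈ (Finset.univ : Finset (Fin k)).offDiag, a p.1 = (k - 1) * Nat.card V := by
    rw [← ha, Finset.mul_sum, hoff, Finset.sum_filter, Fintype.sum_prod_type]
    refine Finset.sum_congr rfl fun i _ => ?_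
    dsimp only
    rw [← Finset.sum_filter, Finset.sum_const, smul_eq_mul, Finset.filter_ne,
      Finset.card_erase_of_mem (Finset.mem_univ _), Finset.card_univ, Fintype.card_fin]
  have hsnd : ∑ p ∈ (Finset.univ : Finset (Fin k)).offDiag, a p.2 = (k - 1) * Nat.card V := by
    rw [← ha, Finset.mul_sum, hoff, Finset.sum_filter, Fintype.sum_prod_type_right]
    refine Finset.sum_congr rfl fun i _ => ?_
    dsimp only
    rw [← Finset.sum_filter, Finset.sum_const, smul_eq_mul, Finset.filter_ne',
      Finset.card_erase_of_mem (Finset.mem_univ _), Finset.card_univ, Fintype.card_fin]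
  have hk : k * k - k = 2 * k.choose 2 := by
    rw [Nat.choose_two_right, Nat.mul_div_cancel' (Nat.even_mul_pred_self k).two_dvd,
      Nat.mul_sub_one]
  rw [← hfst] at hsnd ⊢
  change ∑ p ∈ (Finset.univ : Finset (Fin k)).offDiag, a p.1 +
    ∑ p ∈ (Finset.univ : Finset (Fin k)).offDiag, a p.2 ≤ _ at hle
  omega

/-! ### From partitions to colorings with `k` colors -/

theorem encard_colorClasses_of_surjective {G : SimpleGraph V} {α : Type v} (c : G.Coloring α)
    (hc : Function.Surjective c) : c.colorClasses.encard = ENat.card α := by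
  have hinj : Function.Injective c.colorClass := by
    intro i j hij
    obtain ⟨x, hx⟩ := hc i
    have : x ∈ c.colorClass j := hij ▸ hx
    exact hx.symm.trans this
  have : c.colorClasses = Set.range c.colorClass := by
    ext s
    constructor
    · rintro ⟨x, rfl⟩
      exact ⟨c x, rfl⟩
    · rintro ⟨i, rfl⟩
      obtain ⟨x, rfl⟩ := hc i
      exact ⟨x, rfl⟩
  rw [this, ← Set.image_univ, hinj.encard_image, Set.encard_univ]

theorem Coloring.eq_iff_exists_mem_colorClasses {G : SimpleGraph V} {α : Type v}
    (c : G.Coloring α) (x y : V) : c x = c y ↔ ∃ s ∈ c.colorClasses, x ∈ s ∧ y ∈ s := by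
  constructor
  · exact fun h => ⟨c.colorClass (c y), ⟨y, rfl⟩, h, rfl⟩
  · rintro ⟨_, ⟨z, rfl⟩, hx, hy⟩
    exact Eq.trans hx (Eq.symm hy)

theorem mul_card_le_of_existsUnique_partition [Finite V] {G : SimpleGraph V} {k : ℕ}
    (hk : G.chromaticNumber = k)
    (hunique : ∃! C : G.Partition, C.parts.encard = G.chromaticNumber) :
    (k - 1) * Nat.card V ≤ G.edgeSet.ncard + k.choose 2 := by
  obtain ⟨P, -, hP⟩ := hunique
  -- An unused color would contradict the minimality of `k`.
  have hsurj : ∀ c : G.Coloring (Fin k), Function.Surjective c :=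
    le_chromaticNumber_iff_forall_surjective.1 hk.ge
  have hparts : ∀ c : G.Coloring (Fin k), c.colorClasses = P.parts := by
    intro c
    rw [← hP c.toPartition]
    · rfl
    · rw [hk]
      exact (encard_colorClasses_of_surjective c (hsurj c)).trans (by simp)
  obtain ⟨c⟩ : G.Colorable k := chromaticNumber_le_iff_colorable.1 hk.le
  refine mul_card_le_of_connected c fun i j hij =>
    connected_induce_of_unique_coloring c (hsurj c) (fun c' x y => ?_) hij
  rw [c.eq_iff_exists_mem_colorClasses, c'.eq_iff_exists_mem_colorClasses, hparts, hparts]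

end SimpleGraph

open SimpleGraph in
theorem theorem1 {V : Type*} [Finite V] (G : SimpleGraph V)
    (hχ : G.chromaticNumber ≤ 6)
    (hunique : ∃! C : G.Partition, C.parts.encard = G.chromaticNumber) :
    G.chromaticNumber ≤ G.hadwigerNumber := by
  obtain ⟨k, hk⟩ := ENat.ne_top_iff_exists.1 (ne_top_of_le_ne_top (by simp) hχ)
  have he := mul_card_le_of_existsUnique_partition hk.symm hunique
  have hcol : G.Colorable (Nat.card V) := by
    have := Fintype.ofFinite V
    rw [Nat.card_eq_fintype_card]
    exact G.colorable_of_fintype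
  have hn := hcol.chromaticNumber_le
  rw [← hk] at hχ hn ⊢
  have hn : k ≤ Nat.card V := by exact_mod_cast hn
  have hk6 : k ≤ 6 := by exact_mod_cast hχ
  rcases Nat.eq_zero_or_pos k with rfl | hpos
  · simp
  have : Nonempty V := Finite.card_pos_iff.1 (hpos.trans_le hn)
  refine HasCliqueMinor.le_hadwigerNumber ?_
  -- For k = 4 and k = 5 the bounds 3n - 6 and 4n - 10 exceed the required 2n - 2 and 3n - 5 by n -
  -- k ≥ 0; for k = 2, 3, 6 they coincide with the required ones.
  interval_cases k <;> simp only [Nat.choose] at he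
  · exact hasCliqueMinor_one G
  · exact hasCliqueMinor_two hn (by omega)
  · exact hasCliqueMinor_three hn (by omega)
  · exact hasCliqueMinor_four hn (by omega)
  · exact hasCliqueMinor_five hn (by omega)
  · exact hasCliqueMinor_six hn (by omega)
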